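/- Let $k$ be an algebraically closed field, $A$ a finite-dimensional $k$-algebra and $B\subseteq A$ a unital subalgebra. Let $Q_A$ be a connected quiver with finite vertex set and $Q_B$ a subquiver of $Q_A$ with the same vertices, and let $\nu=(\nu_A,\nu_B)$ be a presentation of $A$ relative to $B$: surjective $k$-algebra maps $\nu_A:kQ_A\to A$ and $\nu_B:kQ_B\to B$, each injective on the set of vertices, such that $\nu_A|_{kQ_B}=\nu_B$. Assume that $\nu_A$ maps every vertex to a primitive idempotent and no arrow to $0$ (this holds, for instance, if $A$ is basic and $Q_A$ is its Gabriel quiver); the ideal $I_A=\ker\nu_A$ need not be admissible. A walk is a path in the quiver obtained from $Q_A$ by adding formal inverses of all arrows; paths are composed from right to left. A relation $r\in I_A$ is minimal if no proper non-empty subsum of $r$ (as a linear combination of paths) lies in $I_A$. Homotopy of walks is the equivalence relation, compatible with composition, that is generated by $\alpha^{-1}\alpha\sim s(\alpha)$ and $\alpha\alpha^{-1}\sim t(\alpha)$ for every arrow $\alpha$, and by $u\sim v$ whenever the paths $u,v$ both appear with non-zero coefficient in a minimal relation. For a vertex $*$ let $\pi_1(Q_A,I_A)=\pi_1(Q_A,I_A,*)$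 be the group of homotopy classes of closed walks at $*$, and let $N_B$ be its (normal) subgroup generated by the classes $[v^{-1}(u')^{-1}uv]$, where $u,u'$ are parallel walks in $Q_B$ and $v$ is a walk in $Q_A$ from $*$ to the source of $u$. Let $\mathrm{HH}^1(A)=\mathrm{Der}_k(A)/\mathrm{Inn}_k(A)$ and $\mathrm{HH}^1(A|B)=\mathrm{Der}_{B^e}(A)/\mathrm{Inn}_{B^e}(A)$, where the index $B^e$ means that only (inner) derivations that are homomorphisms of $B$-bimodules are taken. Let $\iota:\mathrm{Hom}(\pi_1(Q_A,I_A)/N_B,k)\to\mathrm{Hom}(\pi_1(Q_A,I_A),k)$ and $\iota_{\mathrm{HH}}:\mathrm{HH}^1(A|B)\to\mathrm{HH}^1(A)$ be the canonical maps. A parade data $\gamma$ is a choice of a walk $\gamma_x$ from $*$ to $x$ for every vertex $x$. It is a relative parade data if there are a vertex $x_i$ in each connected component $\Gamma_i$ of $Q_B$ and a walk $\gamma_{*,x_i}$ in $Q_A$ from $*$ to $x_i$ such that for every vertex $y$ of $\Gamma_i$ the walk $\gamma_y$ is $\gamma_{*,x_i}$ followed by a walk in $Q_B$ from $x_i$ to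 $y$. For a path $p$ put $\mathrm{cl}_\gamma(p)=[\gamma_{t(p)}^{-1}\,p\,\gamma_{s(p)}]$, and for $f\in\mathrm{Hom}(\pi_1(Q_A,I_A),k)$ let $\theta_{\nu,\gamma}(f)$ be the derivation of $A$ with $\nu_A(p)\mapsto f(\mathrm{cl}_\gamma(p))\,\nu_A(p)$ for all paths $p$. Then the class $\theta_\nu(f)$ of $\theta_{\nu,\gamma}(f)$ in $\mathrm{HH}^1(A)$ does not depend on the parade data $\gamma$, relative parade data exist, and there is an injective linear map $$\theta_\nu^{(A|B)}:\mathrm{Hom}(\pi_1(Q_A,I_A)/N_B,k)\to\mathrm{HH}^1(A|B)$$ such that for every relative parade data $\gamma$ and every $f$ the derivation $\theta_{\nu,\gamma}(\iota f)$ lies in $\mathrm{Der}_{B^e}(A)$ and has class $\theta_\nu^{(A|B)}(f)$ in $\mathrm{HH}^1(A|B)$. Moreover, the square $$\begin{array}{ccc}\mathrm{Hom}(\pi_1(Q_A,I_A),k)&\xrightarrow{\ \theta_\nu\ }&\mathrm{HH}^1(A)\\ {\scriptstyle\iota}\uparrow&&\uparrow{\scriptstyle\iota_{\mathrm{HH}}}\\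 \mathrm{Hom}(\pi_1(Q_A,I_A)/N_B,k)&\xrightarrow{\ \theta_\nu^{(A|B)}\ }&\mathrm{HH}^1(A|B)\end{array}$$ is a pullback square of $k$-vector spaces. -/

import Mathlib

open Quiver

noncomputable section

namespace RelHH

universe u v w

/-! ### The path algebra of a quiver -/

/-- A path of a quiver together with its source and its target. -/
structure TotalPath (V : Type u) [Quiver.{v} V] where
  src : V
  tgt : V
  path : Path src tgt

/-- The path algebra `kQ`: formal linear combinations of paths. -/
def PathAlgebra (k : Type w) [Field k] (V : Type u) [Quiver.{v} V] := TotalPath V →₀ k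

namespace PathAlgebra

variable {k : Type w} [Field k] {V : Type u} [Quiver.{v} V]

instance : AddCommGroup (PathAlgebra k V) := inferInstanceAs (AddCommGroup (TotalPath V →₀ k))
instance : Module k (PathAlgebra k V) := inferInstanceAs (Module k (TotalPath V →₀ k))

variable (k) in
/-- The basis element of the path algebra given by a path. -/
def ofPath {x y : V} (p : Path x y) : PathAlgebra k V := Finsupp.single ⟨x, y, p⟩ 1

/-- Linear extension of a map that is given on paths. -/
def lin {M : Type*} [AddCommGroup M] [Module k M] (φ : TotalPath V → M) :
    PathAlgebra k V →ₗ[k] M := Finsupp.linearCombination k φ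

theorem lin_ofPath {M : Type*} [AddCommGroup M] [Module k M] (φ : TotalPath V → M)
    {x y : V} (p : Path x y) : lin φ (ofPath k p) = φ ⟨x, y, p⟩ := by
  exact (Finsupp.linearCombination_single k 1 _).trans (one_smul k _)

theorem hom_ext {M : Type*} [AddCommGroup M] [Module k M] {φ ψ : PathAlgebra k V →ₗ[k] M}
    (h : ∀ {x y : V} (p : Path x y), φ (ofPath k p) = ψ (ofPath k p)) : φ = ψ :=
  Finsupp.lhom_ext' fun p => LinearMap.ext_ring (h p.path)

open Classical in
variable (k) in
/-- The product `p q` of two paths (first `q`, then `p`), which is `0` unless `q` ends where `p`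
starts. -/
def mulPath (p q : TotalPath V) : PathAlgebra k V :=
  if h : q.tgt = p.src then ofPath k (q.path.comp (p.path.cast h.symm rfl)) else 0

/-- The multiplication of the path algebra as a bilinear map. -/
def mulL : PathAlgebra k V →ₗ[k] PathAlgebra k V →ₗ[k] PathAlgebra k V :=
  lin fun p => lin fun q => mulPath k p q

instance : Mul (PathAlgebra k V) := ⟨fun r s => mulL r s⟩

theorem mul_def (r s : PathAlgebra k V) : r * s = mulL r s := rfl

theorem ofPath_mul_ofPath {x y z : V} (p : Path y z) (q : Path x y) :
    ofPath k p * ofPath k q = ofPath k (q.comp p) := by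
  simp [mul_def, mulL, lin_ofPath, mulPath]

theorem ofPath_mul_ofPath_of_ne {x y y' z : V} (p : Path y' z) (q : Path x y) (h : y ≠ y') :
    ofPath k p * ofPath k q = 0 := by
  simp [mul_def, mulL, lin_ofPath, mulPath, h]

instance [Fintype V] : One (PathAlgebra k V) := ⟨∑ x : V, ofPath k (Path.nil : Path x x)⟩

theorem one_def [Fintype V] :
    (1 : PathAlgebra k V) = ∑ x : V, ofPath k (Path.nil : Path x x) := rfl

theorem one_mul_aux [Fintype V] (r : PathAlgebra k V) : 1 * r = r := by
  suffices h : mulL (1 : PathAlgebra k V) = LinearMap.id from LinearMap.congr_fun h r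
  refine hom_ext fun {x y} p => ?_
  rw [one_def, map_sum, LinearMap.sum_apply, Finset.sum_eq_single y]
  · exact ofPath_mul_ofPath _ _
  · exact fun z _ hz => ofPath_mul_ofPath_of_ne _ _ hz.symm
  · simp

theorem mul_one_aux [Fintype V] (r : PathAlgebra k V) : r * 1 = r := by
  suffices h : mulL.flip (1 : PathAlgebra k V) = LinearMap.id from LinearMap.congr_fun h r
  refine hom_ext fun {x y} p => ?_
  rw [one_def, map_sum, LinearMap.sum_apply, Finset.sum_eq_single x]
  · exact (ofPath_mul_ofPath p Path.nil).trans (by simp)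
  · exact fun z _ hz => ofPath_mul_ofPath_of_ne p Path.nil hz
  · simp

theorem induction {P : PathAlgebra k V → Prop} (h0 : P 0) (hadd : ∀ r s, P r → P s → P (r + s))
    (hpath : ∀ (c : k) {x y : V} (p : Path x y), P (c • ofPath k p)) (r : PathAlgebra k V) :
    P r := by
  refine Finsupp.induction_linear r h0 (fun r s => hadd r s) fun p c => ?_
  have := hpath c p.path
  have e : c • ofPath k p.path = (Finsupp.single p c : TotalPath V →₀ k) :=
    (Finsupp.smul_single c p (1 : k)).trans (by simp)
  rwa [e] at this

theorem mul_assoc_aux (r s t : PathAlgebra k V) : r * s * t = r * (s * t) := by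
  simp only [mul_def]
  induction r using induction with
  | h0 => simp
  | hadd a b ha hb => simp only [map_add, LinearMap.add_apply, ha, hb]
  | hpath c p =>
  induction s using induction with
  | h0 => simp
  | hadd a b ha hb => simp only [map_add, LinearMap.add_apply, ha, hb]
  | hpath d q =>
  induction t using induction with
  | h0 => simp
  | hadd a b ha hb => simp only [map_add, ha, hb]
  | @hpath e x y l =>
  simp only [map_smul, LinearMap.smul_apply]
  congr 3
  rename_i x₁ y₁ x₂ y₂
  simp only [← mul_def]
  by_cases h : y₂ = x₁
  · subst h
    rw [ofPath_mul_ofPath]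
    by_cases h' : y = x₂
    · subst h'
      rw [ofPath_mul_ofPath, ofPath_mul_ofPath, ofPath_mul_ofPath, Path.comp_assoc]
    · rw [ofPath_mul_ofPath_of_ne _ _ h', ofPath_mul_ofPath_of_ne _ _ h']
      exact (map_zero _).symm
  · rw [ofPath_mul_ofPath_of_ne _ _ h]
    by_cases h' : y = x₂
    · subst h'
      rw [ofPath_mul_ofPath, ofPath_mul_ofPath_of_ne _ _ h]
      exact LinearMap.congr_fun (map_zero mulL) _
    · rw [ofPath_mul_ofPath_of_ne _ _ h']
      exact (LinearMap.congr_fun (map_zero mulL) _).trans (map_zero _).symm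

instance [Fintype V] : Ring (PathAlgebra k V) where
  __ := (inferInstance : AddCommGroup (PathAlgebra k V))
  mul_assoc := mul_assoc_aux
  one_mul := one_mul_aux
  mul_one := mul_one_aux
  left_distrib r s t := map_add (mulL r) s t
  right_distrib r s t := LinearMap.congr_fun (map_add mulL r s) t
  zero_mul r := LinearMap.congr_fun (map_zero mulL) r
  mul_zero r := map_zero (mulL r)

instance [Fintype V] : Algebra k (PathAlgebra k V) :=
  Algebra.ofModule (fun c r s => LinearMap.congr_fun (map_smul mulL c r) s)
    (fun c r s => map_smul (mulL r) c s)

/-- The coefficient of a path in an element of the path algebra. -/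
def coeff (r : PathAlgebra k V) (p : TotalPath V) : k := Finsupp.toFun r p

/-- The set of the paths that appear with non-zero coefficient. -/
def support (r : PathAlgebra k V) : Finset (TotalPath V) := Finsupp.support r

open Classical in
/-- The subsum of `r` over the paths in `S`. -/
def subsum (S : Set (TotalPath V)) (r : PathAlgebra k V) : PathAlgebra k V :=
  Finsupp.filter (· ∈ S) r

theorem ext_coeff {r s : PathAlgebra k V} (h : ∀ p, r.coeff p = s.coeff p) : r = s :=
  Finsupp.ext h

theorem mem_support {r : PathAlgebra k V} {p : TotalPath V} : p ∈ r.support ↔ r.coeff p ≠ 0 :=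
  Finsupp.mem_support_iff

theorem coeff_zero (p : TotalPath V) : (0 : PathAlgebra k V).coeff p = 0 := rfl

theorem coeff_add (r s : PathAlgebra k V) (p : TotalPath V) :
    (r + s).coeff p = r.coeff p + s.coeff p := rfl

theorem coeff_smul (c : k) (r : PathAlgebra k V) (p : TotalPath V) :
    (c • r).coeff p = c * r.coeff p := rfl

open Classical in
theorem coeff_ofPath {x y : V} (q : Path x y) (p : TotalPath V) :
    (ofPath k q).coeff p = if (⟨x, y, q⟩ : TotalPath V) = p then 1 else 0 :=
  Finsupp.single_apply

open Classical in
theorem coeff_subsum (S : Set (TotalPath V)) (r : PathAlgebra k V) (p : TotalPath V) :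
    (subsum S r).coeff p = if p ∈ S then r.coeff p else 0 :=
  Finsupp.filter_apply _ _ _

/-- The idempotent of the path algebra given by a vertex. -/
def vertex (k : Type w) [Field k] {V : Type u} [Quiver.{v} V] (x : V) : PathAlgebra k V :=
  ofPath k (Path.nil : Path x x)

/-- The element of the path algebra given by an arrow. -/
def arrow (k : Type w) [Field k] {V : Type u} [Quiver.{v} V] {x y : V} (a : x ⟶ y) :
    PathAlgebra k V :=
  ofPath k a.toPath

end PathAlgebra

/-! ### Subquivers with the same vertices -/

section Sub

variable {V : Type u} [Quiver.{v} V]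

instance [Fintype V] (H : WideSubquiver V) : Fintype H := inferInstanceAs (Fintype V)

/-- The inclusion of a subquiver. -/
def subInclusion (H : WideSubquiver V) : H ⥤q V where
  obj x := x
  map a := a.1

/-- The inclusion of path algebras `kQ_B → kQ_A` that is induced by a subquiver `Q_B` of `Q_A`. -/
def pathInclusion (k : Type w) [Field k] [Fintype V] (H : WideSubquiver V) :
    PathAlgebra k H →ₐ[k] PathAlgebra k V :=
  AlgHom.ofLinearMap
    (PathAlgebra.lin fun p => PathAlgebra.ofPath k ((subInclusion H).mapPath p.path))
    (by
      rw [PathAlgebra.one_def, map_sum]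
      exact Finset.sum_congr rfl fun x _ => PathAlgebra.lin_ofPath _ _)
    (by
      intro r s
      induction r using PathAlgebra.induction with
      | h0 => simp
      | hadd a b ha hb => simp only [map_add, add_mul, ha, hb]
      | hpath c p =>
      induction s using PathAlgebra.induction with
      | h0 => simp
      | hadd a b ha hb => simp only [map_add, mul_add, ha, hb]
      | @hpath d x₂ y₂ q =>
      rename_i x₁ y₁
      simp only [map_smul, smul_mul_assoc, mul_smul_comm]
      congr 2
      by_cases h : y₂ = x₁
      · subst h
        simp only [PathAlgebra.ofPath_mul_ofPath, PathAlgebra.lin_ofPath, Prefunctor.mapPath_comp]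
      · rw [PathAlgebra.ofPath_mul_ofPath_of_ne _ _ h, PathAlgebra.lin_ofPath,
          PathAlgebra.lin_ofPath, map_zero]
        exact (PathAlgebra.ofPath_mul_ofPath_of_ne (k := k) ((subInclusion H).mapPath _)
          ((subInclusion H).mapPath _) h).symm)

end Sub

/-! ### Walks and the fundamental group of a bound quiver -/

section Walks

variable {V : Type u} [Quiver.{v} V]

/-- A walk is a path in the quiver in which a formal inverse of every arrow has been added. -/
def Walk (x y : V) := @Path (Symmetrify V) _ x y

namespace Walk

/-- The trivial walk at a vertex. -/
def nil {x : V} : Walk x x := @Path.nil (Symmetrify V) _ x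

/-- Composition of walks in diagrammatic order: first `p`, then `q`. -/
def comp {x y z : V} (p : Walk x y) (q : Walk y z) : Walk x z :=
  @Path.comp (Symmetrify V) _ x y z p q

/-- The inverse of a walk. -/
def inv {x y : V} (p : Walk x y) : Walk y x := @Path.reverse (Symmetrify V) _ _ x y p

/-- A path, viewed as a walk. -/
def ofPath {x y : V} (p : Path x y) : Walk x y := Symmetrify.of.mapPath p

/-- The walks in a subquiver. -/
abbrev _root_.RelHH.SubWalk (H : WideSubquiver V) (x y : V) := @Walk H _ x y

/-- A walk in a subquiver, viewed as a walk in the whole quiver. -/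
def ofSub {H : WideSubquiver V} {x y : V} (u : SubWalk H x y) : Walk x y :=
  (subInclusion H).symmetrify.mapPath u

theorem comp_assoc {x y z t : V} (p : Walk x y) (q : Walk y z) (r : Walk z t) :
    (p.comp q).comp r = p.comp (q.comp r) := Path.comp_assoc (V := Symmetrify V) p q r

theorem nil_comp {x y : V} (p : Walk x y) : nil.comp p = p := Path.nil_comp (V := Symmetrify V) p

theorem comp_nil {x y : V} (p : Walk x y) : p.comp nil = p := Path.comp_nil (V := Symmetrify V) p

theorem inv_inv {x y : V} (p : Walk x y) : p.inv.inv = p :=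
  Path.reverse_reverse (V := Symmetrify V) p

theorem inv_comp {x y z : V} (p : Walk x y) (q : Walk y z) :
    (p.comp q).inv = q.inv.comp p.inv := Path.reverse_comp (V := Symmetrify V) p q

theorem ofPath_comp {x y z : V} (p : Path x y) (q : Path y z) :
    ofPath (p.comp q) = (ofPath p).comp (ofPath q) := Symmetrify.of.mapPath_comp p q

theorem induction {x : V} {P : ∀ {y : V}, Walk x y → Prop} (h0 : P nil)
    (hpos : ∀ {y z : V} (p : Walk x y) (a : y ⟶ z), P p → P (p.comp (ofPath a.toPath)))
    (hneg : ∀ {y z : V} (p : Walk x y) (a : z ⟶ y), P p → P (p.comp (ofPath a.toPath).inv))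
    {y : V} (p : Walk x y) : P p := by
  change @Path (Symmetrify V) _ x y at p
  induction p with
  | nil => exact h0
  | cons p e ih =>
    rcases e with a | a
    · exact hpos p a ih
    · exact hneg p a ih

end Walk

variable {k : Type w} [Field k] [Fintype V]

/-- A minimal relation: an element `r` of `I` such that no proper (non-empty) subsum of `r`
lies in `I`. -/
def IsMinimalRelation (I : Ideal (PathAlgebra k V)) (r : PathAlgebra k V) : Prop :=
  r ∈ I ∧ ∀ S : Finset (TotalPath V), S ⊂ r.support → S.Nonempty → r.subsum S ∉ I

/-- The homotopy relation on walks. -/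
inductive Homotopic (I : Ideal (PathAlgebra k V)) : ∀ {x y : V}, Walk x y → Walk x y → Prop
  | refl {x y : V} (p : Walk x y) : Homotopic I p p
  | symm {x y : V} {p q : Walk x y} : Homotopic I p q → Homotopic I q p
  | trans {x y : V} {p q r : Walk x y} : Homotopic I p q → Homotopic I q r → Homotopic I p r
  | inv_mul {x y : V} (a : x ⟶ y) :
      Homotopic I ((Walk.ofPath a.toPath).comp (Walk.ofPath a.toPath).inv) Walk.nil
  | mul_inv {x y : V} (a : x ⟶ y) :
      Homotopic I ((Walk.ofPath a.toPath).inv.comp (Walk.ofPath a.toPath)) Walk.nil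
  | relation {x y : V} (r : PathAlgebra k V) (hr : IsMinimalRelation I r) (p q : Path x y)
      (hp : ⟨x, y, p⟩ ∈ r.support) (hq : ⟨x, y, q⟩ ∈ r.support) :
      Homotopic I (Walk.ofPath p) (Walk.ofPath q)
  | congr {x y z t : V} (p : Walk x y) {q q' : Walk y z} (r : Walk z t) :
      Homotopic I q q' → Homotopic I ((p.comp q).comp r) ((p.comp q').comp r)

variable {I : Ideal (PathAlgebra k V)}

theorem Homotopic.comp {x y z : V} {p p' : Walk x y} {q q' : Walk y z}
    (hp : Homotopic I p p') (hq : Homotopic I q q') : Homotopic I (p.comp q) (p'.comp q') := by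
  have h1 := Homotopic.congr Walk.nil q hp
  have h2 := Homotopic.congr p' Walk.nil hq
  simp only [Walk.nil_comp, Walk.comp_nil] at h1 h2
  exact h1.trans h2

theorem Homotopic.comp_inv {x y : V} (p : Walk x y) : Homotopic I (p.comp p.inv) Walk.nil := by
  induction p using Walk.induction with
  | h0 => exact .refl _
  | hpos p a ih =>
    have h := Homotopic.congr p p.inv (Homotopic.inv_mul (I := I) a)
    rw [Walk.comp_nil] at h
    rw [Walk.inv_comp]
    simp only [Walk.comp_assoc] at h ⊢
    exact h.trans ih
  | hneg p a ih =>
    have h := Homotopic.congr p p.inv (Homotopic.mul_inv (I := I) a)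
    rw [Walk.comp_nil] at h
    rw [Walk.inv_comp, Walk.inv_inv]
    simp only [Walk.comp_assoc] at h ⊢
    exact h.trans ih

theorem Homotopic.inv_comp {x y : V} (p : Walk x y) : Homotopic I (p.inv.comp p) Walk.nil := by
  have h := Homotopic.comp_inv (I := I) p.inv
  rwa [Walk.inv_inv] at h

theorem Homotopic.inv {x y : V} {p q : Walk x y} (h : Homotopic I p q) :
    Homotopic I p.inv q.inv := by
  have h1 := (Homotopic.refl p.inv).comp (Homotopic.comp_inv (I := I) q)
  have h2 := (Homotopic.inv_comp (I := I) p).comp (Homotopic.refl q.inv)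
  have h3 := Homotopic.congr p.inv q.inv h
  rw [Walk.comp_nil, ← Walk.comp_assoc] at h1
  rw [Walk.nil_comp] at h2
  exact h1.symm.trans (h3.symm.trans h2)

/-- Homotopy as an equivalence relation. -/
def homotopySetoid (I : Ideal (PathAlgebra k V)) (x y : V) : Setoid (Walk x y) where
  r := Homotopic I
  iseqv := ⟨.refl, .symm, .trans⟩

/-- The fundamental group `π₁(Q, I, b)`: closed walks at `b` up to homotopy. -/
def FundGroup (I : Ideal (PathAlgebra k V)) (b : V) := Quotient (homotopySetoid I b b)

namespace FundGroup

/-- The class of a closed walk. -/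
def mk (I : Ideal (PathAlgebra k V)) {b : V} (p : Walk b b) : FundGroup I b :=
  Quotient.mk (homotopySetoid I b b) p

theorem mk_eq {b : V} {p q : Walk b b} (h : Homotopic I p q) : mk I p = mk I q :=
  Quotient.sound h

/-- The product `[p] [q]` is the class of the walk `p q` (first `q`, then `p`). -/
instance (b : V) : Group (FundGroup I b) where
  mul := Quotient.map₂ (fun p q => q.comp p) fun _ _ hp _ _ hq => Homotopic.comp hq hp
  one := mk I Walk.nil
  inv := Quotient.map Walk.inv fun _ _ h => Homotopic.inv h
  mul_assoc := by
    rintro ⟨p⟩ ⟨q⟩ ⟨r⟩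
    exact congrArg (mk I) (Walk.comp_assoc r q p).symm
  one_mul := by
    rintro ⟨p⟩
    exact congrArg (mk I) (Walk.comp_nil p)
  mul_one := by
    rintro ⟨p⟩
    exact congrArg (mk I) (Walk.nil_comp p)
  inv_mul_cancel := by
    rintro ⟨p⟩
    exact mk_eq (Homotopic.comp_inv p)

theorem mk_mul_mk {b : V} (p q : Walk b b) : mk I p * mk I q = mk I (q.comp p) := rfl

theorem mk_inv {b : V} (p : Walk b b) : (mk I p)⁻¹ = mk I p.inv := rfl

theorem mk_nil {b : V} : mk I (Walk.nil : Walk b b) = 1 := rfl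

end FundGroup

/-- The subgroup `N_B` of `π₁(Q_A, I_A, b)`, generated by the classes of the closed walks
`v⁻¹ u'⁻¹ u v`, where `u` and `u'` are parallel walks in `Q_B` and `v` is a walk in `Q_A` that
starts at `b`. -/
def contractSubgroup (I : Ideal (PathAlgebra k V)) (H : WideSubquiver V) (b : V) :
    Subgroup (FundGroup I b) :=
  Subgroup.closure {g | ∃ (x y : V) (u u' : SubWalk H x y) (v : Walk b x),
    g = FundGroup.mk I (((v.comp (Walk.ofSub u)).comp (Walk.ofSub u').inv).comp v.inv)}

instance (I : Ideal (PathAlgebra k V)) (H : WideSubquiver V) (b : V) :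
    (contractSubgroup I H b).Normal where
  conj_mem n hn g := by
    induction hn using Subgroup.closure_induction with
    | mem n hn =>
      obtain ⟨x, y, u, u', v, rfl⟩ := hn
      induction g using Quotient.inductionOn with
      | h g =>
      refine Subgroup.subset_closure ⟨x, y, u, u', g.inv.comp v, ?_⟩
      refine congrArg (FundGroup.mk I) ?_
      change g.inv.comp (Walk.comp _ g) = _
      simp only [Walk.comp_assoc, Walk.inv_comp, Walk.inv_inv]
    | one => simp
    | mul a b _ _ ha hb =>
      have := Subgroup.mul_mem _ ha hb
      simpa [mul_assoc] using this
    | inv a _ ha =>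
      have := Subgroup.inv_mem _ ha
      simpa [mul_assoc] using this

end Walks

/-! ### First (relative) Hochschild cohomology -/

section Hochschild

variable (k : Type*) [Field k] {A : Type*} [Ring A] [Algebra k A]

instance (M : Submodule k (A →ₗ[k] A)) : AddCommGroup M := Submodule.addCommGroup M

variable (A) in
/-- The `k`-linear derivations of `A`. -/
def Der : Submodule k (A →ₗ[k] A) where
  carrier := {D | ∀ x y, D (x * y) = x * D y + D x * y}
  add_mem' {D E} hD hE x y := by
    simp only [LinearMap.add_apply, hD x y, hE x y, mul_add, add_mul]; abel
  zero_mem' x y := by simp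
  smul_mem' c D hD x y := by
    simp only [LinearMap.smul_apply, hD x y, smul_add, mul_smul_comm, smul_mul_assoc]

variable (A) in
/-- The inner derivations `x ↦ a x - x a` of `A`. -/
def Inn : Submodule k (A →ₗ[k] A) :=
  LinearMap.range (LinearMap.mul k A - (LinearMap.mul k A).flip)

variable (A) in
/-- The first Hochschild cohomology `HH¹(A)`: derivations modulo inner derivations. -/
abbrev HH1 := Der k A ⧸ (Inn k A).submoduleOf (Der k A)

variable {k}

/-- The linear maps `A → A` that are homomorphisms of `B`-bimodules. -/
def BimodHom (B : Subalgebra k A) : Submodule k (A →ₗ[k] A) where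
  carrier := {f | ∀ b ∈ B, ∀ x, f (b * x) = b * f x ∧ f (x * b) = f x * b}
  add_mem' {f g} hf hg b hb x := by
    simp only [LinearMap.add_apply, (hf b hb x).1, (hf b hb x).2, (hg b hb x).1, (hg b hb x).2,
      mul_add, add_mul, and_self]
  zero_mem' b _ x := by simp
  smul_mem' c f hf b hb x := by
    simp only [LinearMap.smul_apply, (hf b hb x).1, (hf b hb x).2, mul_smul_comm, smul_mul_assoc,
      and_self]

/-- The derivations of `A` that are homomorphisms of `B`-bimodules. -/
def DerRel (B : Subalgebra k A) : Submodule k (A →ₗ[k] A) := Der k A ⊓ BimodHom B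

/-- The inner derivations of `A` that are homomorphisms of `B`-bimodules. -/
def InnRel (B : Subalgebra k A) : Submodule k (A →ₗ[k] A) := Inn k A ⊓ BimodHom B

/-- The first relative Hochschild cohomology `HH¹(A|B)`. -/
abbrev HH1Rel (B : Subalgebra k A) := DerRel B ⧸ (InnRel B).submoduleOf (DerRel B)

/-- The canonical map `HH¹(A|B) → HH¹(A)`, which sends the class of a derivation to its class. -/
def hhInclusion (B : Subalgebra k A) : HH1Rel B →ₗ[k] HH1 k A :=
  Submodule.mapQ _ _ (Submodule.inclusion (inf_le_left : DerRel B ≤ Der k A))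
    fun _ hD => hD.1

end Hochschild

/-! ### Presentations -/

/-- A primitive idempotent of a ring. -/
def IsPrimitiveIdempotent {A : Type*} [Ring A] (e : A) : Prop :=
  IsIdempotentElem e ∧ e ≠ 0 ∧ ∀ f g : A, IsIdempotentElem f → IsIdempotentElem g →
    f * g = 0 → g * f = 0 → e = f + g → f = 0 ∨ g = 0

/-- A presentation of the algebra `A` by the quiver `V`: a surjective algebra map `ν : kQ → A`
under which the vertices correspond bijectively to a complete set of orthogonal idempotents
(the images of the vertices are automatically orthogonal idempotents with sum `1`). The kernel need
not be admissible. -/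
structure Presentation (k : Type*) [Field k] (A : Type*) [Ring A] [Algebra k A]
    (V : Type u) [Quiver.{v} V] [Fintype V] where
  map : PathAlgebra k V →ₐ[k] A
  surjective : Function.Surjective map
  vertex_injective : Function.Injective fun x : V => map (PathAlgebra.vertex k x)

/-- The ideal of relations of a presentation. -/
def Presentation.ideal {k : Type*} [Field k] {A : Type*} [Ring A] [Algebra k A]
    {V : Type u} [Quiver.{v} V] [Fintype V] (ν : Presentation k A V) : Ideal (PathAlgebra k V) :=
  RingHom.ker ν.map

/-- A presentation of `A` relative to the subalgebra `B`, where the quiver of `B` is a subquiver of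
the quiver of `A`. -/
structure RelPresentation {k : Type*} [Field k] {A : Type*} [Ring A] [Algebra k A]
    (B : Subalgebra k A) {V : Type u} [Quiver.{v} V] [Fintype V] (H : WideSubquiver V) where
  presA : Presentation k A V
  presB : Presentation k B H
  comm : ∀ r : PathAlgebra k H, presA.map (pathInclusion k H r) = (presB.map r : A)

/-! ### The maps from the dual fundamental groups to Hochschild cohomology -/

/-- A parade data with base point `b`: for every vertex `x` a walk from `b` to `x`. -/
abbrev ParadeData {V : Type u} [Quiver.{v} V] (b : V) := ∀ x : V, Walk b x

/-- The connected component of a vertex in a subquiver. -/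
def component {V : Type u} [Quiver.{v} V] (H : WideSubquiver V) (x : V) :
    WeaklyConnectedComponent H :=
  WeaklyConnectedComponent.mk (V := H) x

/-- A relative parade data: for every connected component of `Q_B` a vertex of that component and
a walk in `Q_A` from the base point to this vertex, and for every vertex `y` a walk in `Q_B` to `y`
from the chosen vertex of the component of `y`. -/
structure RelParadeData {V : Type u} [Quiver.{v} V] (H : WideSubquiver V) (b : V) where
  root : WeaklyConnectedComponent H → V
  root_mem : ∀ c, component H (root c) = c
  toRoot : ∀ c, Walk b (root c)
  fromRoot : ∀ y : V, SubWalk H (root (component H y)) y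

/-- The parade data that is given by a relative parade data. -/
def RelParadeData.parade {V : Type u} [Quiver.{v} V] {H : WideSubquiver V} {b : V}
    (γ : RelParadeData H b) : ParadeData b :=
  fun y => (γ.toRoot (component H y)).comp (Walk.ofSub (γ.fromRoot y))

section Theta

variable {k : Type*} [Field k] {A : Type*} [Ring A] [Algebra k A]
  {V : Type u} [Quiver.{v} V] [Fintype V]

/-- The group of homomorphisms from a group to the additive group of the field, as a vector
space. -/
abbrev DualGroup (k : Type*) [Field k] (G : Type*) [Group G] := Additive G →+ k

/-- The map `Hom(G/N, k) → Hom(G, k)` induced by the projection `G → G/N`. -/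
def dualInclusion (k : Type*) [Field k] {G : Type*} [Group G] (N : Subgroup G) [N.Normal] :
    DualGroup k (G ⧸ N) →ₗ[k] DualGroup k G where
  toFun f := f.comp (MonoidHom.toAdditive (QuotientGroup.mk' N))
  map_add' _ _ := rfl
  map_smul' _ _ := rfl

/-- The closed walk `γ_{t(p)}⁻¹ p γ_{s(p)}` at the base point, as an element of the fundamental
group. -/
def cl (I : Ideal (PathAlgebra k V)) {b : V} (γ : ParadeData b) {x y : V} (p : Path x y) :
    FundGroup I b :=
  FundGroup.mk I (((γ x).comp (Walk.ofPath p)).comp (γ y).inv)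

theorem cl_comp (I : Ideal (PathAlgebra k V)) {b : V} (γ : ParadeData b) {x y z : V}
    (p : Path x y) (q : Path y z) :
    cl I γ (p.comp q) = cl I γ q * cl I γ p := by
  refine FundGroup.mk_eq ?_
  have h := Homotopic.congr ((γ x).comp (Walk.ofPath p)) ((Walk.ofPath q).comp (γ z).inv)
    (Homotopic.inv_comp (I := I) (γ y))
  rw [Walk.comp_nil] at h
  rw [Walk.ofPath_comp]
  simp only [Walk.comp_assoc] at h ⊢
  exact h.symm

theorem cl_congr (I : Ideal (PathAlgebra k V)) {b : V} (γ : ParadeData b) {x y : V}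
    {p q : Path x y} (h : Homotopic I (Walk.ofPath p) (Walk.ofPath q)) :
    cl I γ p = cl I γ q :=
  FundGroup.mk_eq (Homotopic.congr (γ x) (γ y).inv h)

/-- The linear map `p ↦ f(cl_γ(p)) p` from the path algebra to itself. -/
def diagonal (I : Ideal (PathAlgebra k V)) {b : V} (γ : ParadeData b)
    (f : DualGroup k (FundGroup I b)) : PathAlgebra k V →ₗ[k] PathAlgebra k V :=
  PathAlgebra.lin fun p => f (Additive.ofMul (cl I γ p.path)) • PathAlgebra.ofPath k p.path

theorem diagonal_ofPath (I : Ideal (PathAlgebra k V)) {b : V} (γ : ParadeData b)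
    (f : DualGroup k (FundGroup I b)) {x y : V} (p : Path x y) :
    diagonal I γ f (PathAlgebra.ofPath k p) =
      f (Additive.ofMul (cl I γ p)) • PathAlgebra.ofPath k p :=
  PathAlgebra.lin_ofPath _ _

theorem diagonal_mul (I : Ideal (PathAlgebra k V)) {b : V} (γ : ParadeData b)
    (f : DualGroup k (FundGroup I b)) (r s : PathAlgebra k V) :
    diagonal I γ f (r * s) = r * diagonal I γ f s + diagonal I γ f r * s := by
  induction r using PathAlgebra.induction with
  | h0 => simp
  | hadd a b ha hb => simp only [map_add, add_mul, ha, hb]; abel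
  | hpath c p =>
  induction s using PathAlgebra.induction with
  | h0 => simp
  | hadd a b ha hb => simp only [map_add, mul_add, ha, hb]; abel
  | @hpath d x₂ y₂ q =>
  rename_i x₁ y₁
  simp only [map_smul, smul_mul_assoc, mul_smul_comm, diagonal_ofPath]
  by_cases h : y₂ = x₁
  · subst h
    rw [PathAlgebra.ofPath_mul_ofPath, diagonal_ofPath, cl_comp, ofMul_mul, map_add]
    module
  · simp [PathAlgebra.ofPath_mul_ofPath_of_ne _ _ h]

/-- Multiplication by vertices on both sides picks out the paths between the two vertices. -/
theorem vertex_mul_mul_vertex (x y : V) (r : PathAlgebra k V) :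
    PathAlgebra.vertex k y * r * PathAlgebra.vertex k x =
      r.subsum {p | p.src = x ∧ p.tgt = y} := by
  classical
  refine PathAlgebra.ext_coeff fun q => ?_
  rw [PathAlgebra.coeff_subsum]
  induction r using PathAlgebra.induction with
  | h0 => simp [PathAlgebra.coeff_zero]
  | hadd a b ha hb =>
    rw [mul_add, add_mul, PathAlgebra.coeff_add, ha, hb, PathAlgebra.coeff_add]
    split_ifs <;> simp
  | @hpath c z t p =>
    rw [mul_smul_comm, smul_mul_assoc, PathAlgebra.coeff_smul, PathAlgebra.coeff_smul,
      PathAlgebra.coeff_ofPath]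
    unfold PathAlgebra.vertex
    by_cases ht : t = y
    · subst ht
      rw [PathAlgebra.ofPath_mul_ofPath, Path.comp_nil]
      by_cases hz : z = x
      · subst hz
        rw [PathAlgebra.ofPath_mul_ofPath, Path.nil_comp, PathAlgebra.coeff_ofPath]
        by_cases hq : (⟨z, t, p⟩ : TotalPath V) = q
        · subst hq; simp
        · simp [hq]
      · rw [PathAlgebra.ofPath_mul_ofPath_of_ne _ _ (Ne.symm hz), PathAlgebra.coeff_zero]
        by_cases hq : (⟨z, t, p⟩ : TotalPath V) = q
        · subst hq; simp [hz]
        · simp [hq]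
    · rw [PathAlgebra.ofPath_mul_ofPath_of_ne _ _ ht, zero_mul, PathAlgebra.coeff_zero]
      by_cases hq : (⟨z, t, p⟩ : TotalPath V) = q
      · subst hq; simp [ht]
      · simp [hq]

theorem minimal_parallel (I : Ideal (PathAlgebra k V)) (hI : ∀ r s, r ∈ I → r * s ∈ I)
    {r : PathAlgebra k V} (hr : IsMinimalRelation I r) {p q : TotalPath V}
    (hp : p ∈ r.support) (hq : q ∈ r.support) : q.src = p.src ∧ q.tgt = p.tgt := by
  classical
  by_contra h
  refine hr.2 (r.support.filter fun q => q.src = p.src ∧ q.tgt = p.tgt)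
    (Finset.filter_ssubset.2 ⟨q, hq, h⟩) ⟨p, by simpa using hp⟩ ?_
  have h1 := hI _ (PathAlgebra.vertex k p.src)
    (I.mul_mem_left (PathAlgebra.vertex k p.tgt) hr.1)
  rw [vertex_mul_mul_vertex] at h1
  convert h1 using 1
  refine PathAlgebra.ext_coeff fun l => ?_
  rw [PathAlgebra.coeff_subsum, PathAlgebra.coeff_subsum]
  by_cases hl : r.coeff l = 0
  · simp [hl]
  · simp [PathAlgebra.mem_support.2 hl]

theorem coeff_diagonal (I : Ideal (PathAlgebra k V)) {b : V} (γ : ParadeData b)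
    (f : DualGroup k (FundGroup I b)) (r : PathAlgebra k V) (p : TotalPath V) :
    (diagonal I γ f r).coeff p = f (Additive.ofMul (cl I γ p.path)) * r.coeff p := by
  classical
  induction r using PathAlgebra.induction with
  | h0 => rw [map_zero, PathAlgebra.coeff_zero, mul_zero]
  | hadd a b ha hb => rw [map_add, PathAlgebra.coeff_add, ha, hb, PathAlgebra.coeff_add, mul_add]
  | @hpath c z t q =>
    rw [map_smul, diagonal_ofPath, PathAlgebra.coeff_smul, PathAlgebra.coeff_smul,
      PathAlgebra.coeff_smul, PathAlgebra.coeff_ofPath]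
    by_cases h : (⟨z, t, q⟩ : TotalPath V) = p
    · subst h; ring
    · simp [h]

theorem diagonal_mem (I : Ideal (PathAlgebra k V)) (hI : ∀ r s, r ∈ I → r * s ∈ I)
    {b : V} (γ : ParadeData b)
    (f : DualGroup k (FundGroup I b)) (r : PathAlgebra k V) (hr : r ∈ I) :
    diagonal I γ f r ∈ I := by
  classical
  induction h : r.support.card using Nat.strong_induction_on generalizing r with
  | _ n ih =>
  by_cases hmin : IsMinimalRelation I r
  · by_cases h0 : r.support.Nonempty
    · obtain ⟨p, hp⟩ := h0
      have key : diagonal I γ f r = f (Additive.ofMul (cl I γ p.path)) • r := by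
        refine PathAlgebra.ext_coeff fun q => ?_
        rw [coeff_diagonal, PathAlgebra.coeff_smul]
        by_cases hq : q ∈ r.support
        · obtain ⟨h1, h2⟩ := minimal_parallel I hI hmin hp hq
          obtain ⟨x, y, p⟩ := p
          obtain ⟨x', y', q⟩ := q
          obtain rfl : x' = x := h1
          obtain rfl : y' = y := h2
          rw [cl_congr I γ (Homotopic.relation r hmin q p hq hp)]
        · have h2 : r.coeff q = 0 := by simpa [PathAlgebra.mem_support] using hq
          rw [h2, mul_zero, mul_zero]
      rw [key, ← one_mul r, ← smul_mul_assoc]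
      exact I.mul_mem_left _ hr
    · have : r = 0 := PathAlgebra.ext_coeff fun p => by
        by_contra hp
        exact h0 ⟨p, PathAlgebra.mem_support.2 hp⟩
      rw [this, map_zero]
      exact I.zero_mem
  · have h1 : ¬ ∀ S : Finset (TotalPath V), S ⊂ r.support → S.Nonempty → r.subsum S ∉ I :=
      fun h => hmin ⟨hr, h⟩
    push Not at h1
    obtain ⟨S, hS, hne, hr₁⟩ := h1
    have hsum : r.subsum S + r.subsum (S : Set (TotalPath V))ᶜ = r :=
      PathAlgebra.ext_coeff fun p => by
        rw [PathAlgebra.coeff_add, PathAlgebra.coeff_subsum, PathAlgebra.coeff_subsum]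
        by_cases hp : p ∈ S <;> simp [hp]
    have hr₂ : r.subsum (S : Set (TotalPath V))ᶜ ∈ I := by
      rw [← add_sub_cancel_left (r.subsum S) (r.subsum (S : Set (TotalPath V))ᶜ), hsum]
      exact I.sub_mem hr hr₁
    have c₁ : (r.subsum S).support.card < n := by
      rw [← h]
      refine Finset.card_lt_card (lt_of_le_of_lt (fun p hp => ?_) hS)
      rw [PathAlgebra.mem_support, PathAlgebra.coeff_subsum] at hp
      by_contra hpS
      simp [hpS] at hp
    have c₂ : (r.subsum (S : Set (TotalPath V))ᶜ).support.card < n := by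
      rw [← h]
      obtain ⟨p, hp⟩ := hne
      refine Finset.card_lt_card (Finset.ssubset_iff_subset_ne.2 ⟨fun q hq => ?_, fun e => ?_⟩)
      · rw [PathAlgebra.mem_support, PathAlgebra.coeff_subsum] at hq
        rw [PathAlgebra.mem_support]
        intro h0
        simp [h0] at hq
      · have := hS.1 hp
        rw [← e, PathAlgebra.mem_support, PathAlgebra.coeff_subsum] at this
        simp [hp] at this
    rw [← hsum, map_add]
    exact I.add_mem (ih _ c₁ _ hr₁ rfl) (ih _ c₂ _ hr₂ rfl)

/-- The derivation `p ↦ f(cl_γ(p)) p` of `A`. -/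
def thetaEnd (ν : Presentation k A V) {b : V} (γ : ParadeData b)
    (f : DualGroup k (FundGroup ν.ideal b)) : A →ₗ[k] A :=
  (LinearMap.ker ν.map.toLinearMap).liftQ (ν.map.toLinearMap ∘ₗ diagonal ν.ideal γ f)
    (fun r hr => diagonal_mem ν.ideal
      (fun r s h => by
        have h' : ν.map r = 0 := h
        change ν.map (r * s) = 0
        rw [map_mul, h', zero_mul]) γ f r hr) ∘ₗ
    (ν.map.toLinearMap.quotKerEquivOfSurjective ν.surjective).symm.toLinearMap

theorem thetaEnd_map (ν : Presentation k A V) {b : V} (γ : ParadeData b)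
    (f : DualGroup k (FundGroup ν.ideal b)) (r : PathAlgebra k V) :
    thetaEnd ν γ f (ν.map r) = ν.map (diagonal ν.ideal γ f r) := by
  have h : (ν.map.toLinearMap.quotKerEquivOfSurjective ν.surjective).symm (ν.map r) =
      Submodule.Quotient.mk r := by
    rw [LinearEquiv.symm_apply_eq]; rfl
  rw [thetaEnd, LinearMap.comp_apply, LinearEquiv.coe_coe, h]
  rfl

/-- The characterization of the derivation by its values on paths. -/
theorem thetaEnd_ofPath (ν : Presentation k A V) {b : V} (γ : ParadeData b)
    (f : DualGroup k (FundGroup ν.ideal b)) {x y : V} (p : Path x y) :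
    thetaEnd ν γ f (ν.map (PathAlgebra.ofPath k p)) =
      f (Additive.ofMul (cl ν.ideal γ p)) • ν.map (PathAlgebra.ofPath k p) := by
  rw [thetaEnd_map, diagonal_ofPath, map_smul]

/-- The map `θ_{ν,γ} : Hom(π₁(Q, I), k) → Der(A)`, `f ↦ (p ↦ f(cl_γ(p)) p)`. -/
def thetaDer (ν : Presentation k A V) {b : V} (γ : ParadeData b) :
    DualGroup k (FundGroup ν.ideal b) →ₗ[k] Der k A where
  toFun f := ⟨thetaEnd ν γ f, fun x y => by
    obtain ⟨r, rfl⟩ := ν.surjective x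
    obtain ⟨s, rfl⟩ := ν.surjective y
    rw [← map_mul, thetaEnd_map, thetaEnd_map, thetaEnd_map, diagonal_mul, map_add, map_mul,
      map_mul]⟩
  map_add' f g := by
    refine Subtype.ext (LinearMap.ext fun x => ?_)
    obtain ⟨r, rfl⟩ := ν.surjective x
    change thetaEnd ν γ (f + g) (ν.map r) = thetaEnd ν γ f (ν.map r) + thetaEnd ν γ g (ν.map r)
    have h : diagonal ν.ideal γ (f + g) = diagonal ν.ideal γ f + diagonal ν.ideal γ g :=
      PathAlgebra.hom_ext fun p => by
        simp only [diagonal_ofPath, LinearMap.add_apply, AddMonoidHom.add_apply, add_smul]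
    rw [thetaEnd_map, thetaEnd_map, thetaEnd_map, h, LinearMap.add_apply, map_add]
  map_smul' c f := by
    refine Subtype.ext (LinearMap.ext fun x => ?_)
    obtain ⟨r, rfl⟩ := ν.surjective x
    change thetaEnd ν γ (c • f) (ν.map r) = c • thetaEnd ν γ f (ν.map r)
    have h : diagonal ν.ideal γ (c • f) = c • diagonal ν.ideal γ f :=
      PathAlgebra.hom_ext fun p => by
        simp only [diagonal_ofPath, LinearMap.smul_apply, AddMonoidHom.smul_apply, smul_assoc]
    rw [thetaEnd_map, thetaEnd_map, h, LinearMap.smul_apply, map_smul]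

/-- The map `θ_ν : Hom(π₁(Q, I), k) → HH¹(A)`, computed with the parade data `γ`. -/
def theta (ν : Presentation k A V) {b : V} (γ : ParadeData b) :
    DualGroup k (FundGroup ν.ideal b) →ₗ[k] HH1 k A :=
  ((Inn k A).submoduleOf (Der k A)).mkQ ∘ₗ thetaDer ν γ

end Theta

/-- A commutative square of vector spaces
```
  Y --g--> Z
  ^        ^
  i        j
  |        |
  W --h--> X
```
is a pullback square if it has the universal property of a pullback. -/
def IsPullbackSquare.{t, u₀, u₁, u₂, u₃, u₄} {k : Type u₀} {W : Type u₁} {X : Type u₂}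
    {Y : Type u₃} {Z : Type u₄} [Field k] [AddCommGroup W] [Module k W]
    [AddCommGroup X] [Module k X] [AddCommGroup Y] [Module k Y] [AddCommGroup Z] [Module k Z]
    (i : W →ₗ[k] Y) (h : W →ₗ[k] X) (g : Y →ₗ[k] Z) (j : X →ₗ[k] Z) : Prop :=
  g ∘ₗ i = j ∘ₗ h ∧
    ∀ (U : Type t) [AddCommGroup U] [Module k U] (α : U →ₗ[k] Y) (β : U →ₗ[k] X),
      g ∘ₗ α = j ∘ₗ β → ∃! φ : U →ₗ[k] W, i ∘ₗ φ = α ∧ h ∘ₗ φ = β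

end RelHH

end

open RelHH

universe t u₀ u₁ u₂ u₃

/-!
The class `θ(f)` does not see the parade data because changing the latter changes `f ∘ cl` by a
coboundary `c y - c x` on the vertices, that is, changes the diagonal derivation by the commutator
with `∑ c x • e_x`. The converse is the heart of the matter. Suppose that the diagonal derivation of
`f` agrees with a commutator `[s, ·]` on the arrows of a subquiver `H`. The compression `e_x s e_x`
to a split corner is `c x • e_x` up to a nilpotent element; as left and right multiplication by
nilpotent elements differ by a nilpotent operator, the eigenvalue of `[s, ·]` at an arrow `x ⟶ y` of
`H` must be `c y - c x`. So `f` is a coboundary on `H` and vanishes on the subgroup that contracts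
`H`. Taking for `H` the whole quiver gives the injectivity of `θ`, taking `H = Q_B` gives the
pullback property.
-/

namespace RelHH

/-! ### Primitive idempotents and split corners -/

section SplitCorners

open Polynomial

theorem aeval_eq_zero_or_aeval_eq_zero_of_isCoprime {R A : Type*} [CommRing R] [Ring A]
    [Algebra R A] (hA : ∀ f : A, IsIdempotentElem f → f = 0 ∨ f = 1) {p q : R[X]}
    (hpq : IsCoprime p q) {a : A} (ha : aeval a (p * q) = 0) :
    aeval a p = 0 ∨ aeval a q = 0 := by
  obtain ⟨u, v, huv⟩ := hpq
  have hidem : IsIdempotentElem (aeval a (u * p)) := by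
    rw [IsIdempotentElem, ← map_mul, ← sub_eq_zero, ← map_sub,
      show u * p * (u * p) - u * p = -(u * v) * (p * q) by linear_combination u * p * huv,
      map_mul, ha, mul_zero]
  rcases hA _ hidem with h | h
  · left
    rw [show p = p * (u * p) + v * (p * q) by linear_combination -p * huv, map_add, map_mul, h,
      map_mul, ha, mul_zero, mul_zero, add_zero]
  · right
    rw [← mul_one (aeval a q), ← h, ← map_mul, show q * (u * p) = u * (p * q) by ring, map_mul, ha,
      mul_zero]

variable {k : Type*} [Field k] {A : Type*} [Ring A] [Algebra k A]

theorem exists_isNilpotent_sub_algebraMap [IsAlgClosed k] [Nontrivial A] [Algebra.IsIntegral k A]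
    (hA : ∀ f : A, IsIdempotentElem f → f = 0 ∨ f = 1) (a : A) :
    ∃ c : k, IsNilpotent (a - algebraMap k A c) := by
  have ha : IsIntegral k a := Algebra.IsIntegral.isIntegral a
  obtain ⟨c, hc⟩ := IsAlgClosed.exists_root (minpoly k a) (minpoly.degree_pos ha).ne'
  obtain ⟨g, hg, hcg⟩ :=
    exists_eq_pow_rootMultiplicity_mul_and_not_dvd (minpoly k a) (minpoly.ne_zero ha) c
  have hcop : IsCoprime ((X - C c) ^ (minpoly k a).rootMultiplicity c) g :=
    ((irreducible_X_sub_C c).coprime_iff_not_dvd.2 hcg).pow_left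
  refine ⟨c, (minpoly k a).rootMultiplicity c, ?_⟩
  rcases aeval_eq_zero_or_aeval_eq_zero_of_isCoprime hA hcop (hg ▸ minpoly.aeval k a) with h | h
  · simpa only [map_pow, map_sub, aeval_X, aeval_C] using h
  · exact absurd ((dvd_iff_isRoot.2 hc).trans (minpoly.dvd k a h)) hcg

variable {e : A}

instance (he : IsIdempotentElem e) : SMul k he.Corner where
  smul c x := ⟨c • x.1, by
    obtain ⟨y, hy⟩ := x.2
    exact ⟨c • y, by simp only [← hy, mul_smul_comm, smul_mul_assoc]⟩⟩

/-- The inclusion of the corner ring `e A e` into `A`, which does not preserve the unit. -/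
def cornerInclusion (he : IsIdempotentElem e) : he.Corner →ₙ+* A where
  toFun x := x.1
  map_mul' _ _ := rfl
  map_zero' := rfl
  map_add' _ _ := rfl

theorem cornerInclusion_injective (he : IsIdempotentElem e) :
    Function.Injective (cornerInclusion he) :=
  Subtype.val_injective

instance (he : IsIdempotentElem e) : Module k he.Corner :=
  (cornerInclusion_injective he).module k (cornerInclusion he).toAddMonoidHom fun _ _ => rfl

instance (he : IsIdempotentElem e) : Algebra k he.Corner :=
  Algebra.ofModule (fun c x y => Subtype.ext (smul_mul_assoc c x.1 y.1))
    (fun c x y => Subtype.ext (mul_smul_comm c x.1 y.1))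

instance [FiniteDimensional k A] (he : IsIdempotentElem e) : FiniteDimensional k he.Corner :=
  FiniteDimensional.of_injective
    ({ cornerInclusion he with map_smul' := fun _ _ => rfl } : he.Corner →ₗ[k] A)
    (cornerInclusion_injective he)

theorem cornerInclusion_pow_succ (he : IsIdempotentElem e) (x : he.Corner) (n : ℕ) :
    cornerInclusion he (x ^ (n + 1)) = cornerInclusion he x ^ (n + 1) := by
  induction n with
  | zero => rw [zero_add, pow_one, pow_one]
  | succ n ih => rw [pow_succ, map_mul, ih, ← pow_succ]

theorem isNilpotent_cornerInclusion (he : IsIdempotentElem e) {x : he.Corner}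
    (hx : IsNilpotent x) : IsNilpotent (cornerInclusion he x) := by
  obtain ⟨n, hn⟩ := hx
  exact ⟨n + 1, by rw [← cornerInclusion_pow_succ, pow_succ, hn, zero_mul, map_zero]⟩

theorem IsPrimitiveIdempotent.corner_eq_zero_or_eq_one (he : IsPrimitiveIdempotent e)
    (f : he.1.Corner) (hf : IsIdempotentElem f) : f = 0 ∨ f = 1 := by
  set ι := cornerInclusion he.1
  have hι : Function.Injective ι := cornerInclusion_injective he.1
  have hfg : ι f * ι (1 - f) = 0 := by rw [← map_mul, hf.mul_one_sub_self, map_zero]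
  have hgf : ι (1 - f) * ι f = 0 := by rw [← map_mul, hf.one_sub_mul_self, map_zero]
  have hsum : e = ι f + ι (1 - f) := by rw [← map_add, add_sub_cancel]; rfl
  rcases he.2.2 _ _ (hf.map ι) (hf.one_sub.map ι) hfg hgf hsum with h | h
  · exact Or.inl (hι (h.trans (map_zero ι).symm))
  · exact Or.inr (sub_eq_zero.1 (hι (h.trans (map_zero ι).symm))).symm

/-- Every element of the corner `e A e` is a scalar multiple of `e` up to a nilpotent element, as
is the case when `e A e` is local with nilpotent maximal ideal and residue field `k`. -/
def HasSplitCorner (k : Type*) [Field k] {A : Type*} [Ring A] [Algebra k A] (e : A) : Prop :=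
  ∀ a : A, ∃ c : k, IsNilpotent (e * a * e - c • e)

theorem IsPrimitiveIdempotent.hasSplitCorner [IsAlgClosed k] [FiniteDimensional k A]
    (he : IsPrimitiveIdempotent e) : HasSplitCorner k e := by
  intro a
  have : Nontrivial he.1.Corner := ⟨1, 0, fun h => he.2.1 (congrArg Subtype.val h)⟩
  obtain ⟨c, hc⟩ := exists_isNilpotent_sub_algebraMap (k := k) he.corner_eq_zero_or_eq_one
    (⟨e * a * e, a, rfl⟩ : he.1.Corner)
  exact ⟨c, isNilpotent_cornerInclusion he.1 hc⟩

theorem eq_zero_of_mul_sub_mul_eq_smul {m n x : A} (hm : IsNilpotent m) (hn : IsNilpotent n)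
    {c : k} (hx : x ≠ 0) (h : m * x - x * n = c • x) : c = 0 := by
  have hnil : IsNilpotent (LinearMap.mulLeft k m - LinearMap.mulRight k n) :=
    (LinearMap.commute_mulLeft_right m n).isNilpotent_sub
      ((LinearMap.isNilpotent_mulLeft_iff k m).2 hm) ((LinearMap.isNilpotent_mulRight_iff k n).2 hn)
  have hc : Module.End.HasEigenvalue (LinearMap.mulLeft k m - LinearMap.mulRight k n) c :=
    Module.End.hasEigenvalue_of_hasEigenvector ⟨Module.End.mem_eigenspace_iff.2 h, hx⟩
  exact (hc.isNilpotent_of_isNilpotent hnil).eq_zero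

theorem eq_sub_of_smul_eq_commutator {e e' s z : A} {c c' l : k}
    (hc : IsNilpotent (e * s * e - c • e)) (hc' : IsNilpotent (e' * s * e' - c' • e'))
    (hz : z ≠ 0) (hze : z * e = z) (hez : e' * z = z) (h : l • z = s * z - z * s) :
    l = c' - c := by
  refine sub_eq_zero.1 (eq_zero_of_mul_sub_mul_eq_smul hc' hc hz ?_)
  have hcompress : e' * s * z - z * s * e = l • z := by
    calc e' * s * z - z * s * e = e' * s * (z * e) - e' * z * s * e := by rw [hze, hez]
      _ = e' * (s * z - z * s) * e := by simp only [mul_sub, sub_mul, mul_assoc]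
      _ = l • z := by rw [← h, mul_smul_comm, smul_mul_assoc, hez, hze]
  calc (e' * s * e' - c' • e') * z - z * (e * s * e - c • e)
      = (e' * s * (e' * z) - z * e * s * e) - (c' • (e' * z) - c • (z * e)) := by
        simp only [sub_mul, mul_sub, smul_mul_assoc, mul_smul_comm, mul_assoc]; abel
    _ = (l - (c' - c)) • z := by
        rw [hez, hze, hcompress, ← sub_smul, ← sub_smul]

end SplitCorners

/-! ### Linear combinations of vertices -/

namespace PathAlgebra

variable {k : Type*} [Field k] {V : Type*} [Quiver V]

theorem vertex_mul_ofPath {x y : V} (p : Path x y) : vertex k y * ofPath k p = ofPath k p := by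
  rw [vertex, ofPath_mul_ofPath, Path.comp_nil]

theorem ofPath_mul_vertex {x y : V} (p : Path x y) : ofPath k p * vertex k x = ofPath k p := by
  rw [vertex, ofPath_mul_ofPath, Path.nil_comp]

variable [Fintype V]

/-- The element `∑ x, c x • e_x` of the path algebra. Its commutators are the diagonal derivations
that belong to coboundaries. -/
noncomputable def vertexSum (c : V → k) : PathAlgebra k V := ∑ x, c x • vertex k x

theorem vertexSum_mul_ofPath (c : V → k) {x y : V} (p : Path x y) :
    vertexSum c * ofPath k p = c y • ofPath k p := by
  rw [vertexSum, Finset.sum_mul, Finset.sum_eq_single y, smul_mul_assoc, vertex_mul_ofPath]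
  · intro z _ hz
    rw [smul_mul_assoc, vertex, ofPath_mul_ofPath_of_ne _ _ hz.symm, smul_zero]
  · exact fun h => absurd (Finset.mem_univ y) h

theorem ofPath_mul_vertexSum (c : V → k) {x y : V} (p : Path x y) :
    ofPath k p * vertexSum c = c x • ofPath k p := by
  rw [vertexSum, Finset.mul_sum, Finset.sum_eq_single x, mul_smul_comm, ofPath_mul_vertex]
  · intro z _ hz
    rw [mul_smul_comm, vertex, ofPath_mul_ofPath_of_ne _ _ hz, smul_zero]
  · exact fun h => absurd (Finset.mem_univ x) h

theorem vertexSum_commutator_ofPath (c : V → k) {x y : V} (p : Path x y) :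
    vertexSum c * ofPath k p - ofPath k p * vertexSum c = (c y - c x) • ofPath k p := by
  rw [vertexSum_mul_ofPath, ofPath_mul_vertexSum, sub_smul]

theorem pathInclusion_ofPath {H : WideSubquiver V} {x y : H} (p : Path x y) :
    pathInclusion k H (ofPath k p) = ofPath k ((subInclusion H).mapPath p) :=
  lin_ofPath _ p

end PathAlgebra

/-! ### Walks and their classes in the fundamental group -/

section SubWalks

variable {V : Type*} [Quiver V] {H : WideSubquiver V}

theorem Walk.ofSub_comp {x y z : V} (p : SubWalk H x y) (q : SubWalk H y z) :
    Walk.ofSub (H := H) (@Walk.comp H _ x y z p q) = (Walk.ofSub p).comp (Walk.ofSub q) :=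
  (subInclusion H).symmetrify.mapPath_comp p q

theorem Walk.ofSub_ofPath {x y : H} (p : Path x y) :
    Walk.ofSub (H := H) (Walk.ofPath (V := H) p) = Walk.ofPath ((subInclusion H).mapPath p) := by
  induction p with
  | nil => rfl
  | cons p a ih =>
    exact congrArg (fun w => Walk.comp w (Walk.ofPath (Quiver.Hom.toPath (V := V) a.1))) ih

theorem Walk.ofSub_induction {x : V} {P : ∀ {y : V}, Walk x y → Prop} (h0 : P Walk.nil)
    (hpos : ∀ {y z : V} (p : Walk x y) (a : y ⟶ z), a ∈ H y z → P p →
      P (p.comp (Walk.ofPath a.toPath)))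
    (hneg : ∀ {y z : V} (p : Walk x y) (a : z ⟶ y), a ∈ H z y → P p →
      P (p.comp (Walk.ofPath a.toPath).inv))
    {y : V} (w : SubWalk H x y) : P (Walk.ofSub w) :=
  Walk.induction (V := H) (x := x) (P := fun {y} w => P (y := y) (Walk.ofSub w)) h0
    (fun p a ih => hpos (Walk.ofSub p) a.1 a.2 ih)
    (fun p a ih => hneg (Walk.ofSub p) a.1 a.2 ih) w

theorem Walk.exists_ofSub_top_eq {x y : V} (w : Walk x y) :
    ∃ u : SubWalk (⊤ : WideSubquiver V) x y, Walk.ofSub u = w := by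
  let lift : ∀ {y z : V}, (y ⟶ z) → SubWalk (⊤ : WideSubquiver V) y z := fun {y z} a =>
    Walk.ofPath (Quiver.Hom.toPath (V := (⊤ : WideSubquiver V)) (a := y) (b := z) ⟨a, trivial⟩)
  induction w using Walk.induction with
  | h0 => exact ⟨@Walk.nil (⊤ : WideSubquiver V) _ x, rfl⟩
  | hpos p a ih =>
    obtain ⟨u, rfl⟩ := ih
    exact ⟨_, Walk.ofSub_comp u (lift a)⟩
  | hneg p a ih =>
    obtain ⟨u, rfl⟩ := ih
    exact ⟨_, Walk.ofSub_comp u (Walk.inv (lift a))⟩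

end SubWalks

section WalkClass

variable {k : Type*} [Field k] {V : Type*} [Quiver V] [Fintype V]
  {I : Ideal (PathAlgebra k V)} {b : V}

theorem FundGroup.mk_comp_mul_mk_comp_inv {y : V} (p g : Walk b y) (q : Walk y b) :
    mk I (g.comp q) * mk I (p.comp g.inv) = mk I (p.comp q) := by
  rw [mk_mul_mk]
  refine mk_eq ?_
  have h := Homotopic.congr p q (Homotopic.inv_comp (I := I) g)
  rw [Walk.comp_nil] at h
  simpa only [Walk.comp_assoc] using h

theorem contractSubgroup_top (I : Ideal (PathAlgebra k V)) (b : V) :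
    contractSubgroup I ⊤ b = ⊤ := by
  refine (Subgroup.eq_top_iff' _).2 fun g => ?_
  induction g using Quotient.inductionOn with
  | h w =>
    obtain ⟨u, rfl⟩ := w.exists_ofSub_top_eq
    refine Subgroup.subset_closure ⟨b, b, u, Walk.nil (V := (⊤ : WideSubquiver V)), Walk.nil, ?_⟩
    exact congrArg (FundGroup.mk I) (Walk.nil_comp _).symm

variable (I) in
/-- The class of the closed walk `γ_y⁻¹ w γ_x` at the base point, for a walk `w` from `x` to `y`.
This extends `cl` from paths to walks. -/
def walkClass (γ : ParadeData b) {x y : V} (w : Walk x y) : FundGroup I b :=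
  FundGroup.mk I (((γ x).comp w).comp (γ y).inv)

variable (γ : ParadeData b)

theorem walkClass_ofPath {x y : V} (p : Path x y) :
    walkClass I γ (Walk.ofPath p) = cl I γ p := rfl

theorem walkClass_nil (x : V) : walkClass I γ (Walk.nil : Walk x x) = 1 := by
  rw [walkClass, Walk.comp_nil, ← FundGroup.mk_nil]
  exact FundGroup.mk_eq (Homotopic.comp_inv _)

theorem walkClass_comp {x y z : V} (p : Walk x y) (q : Walk y z) :
    walkClass I γ (p.comp q) = walkClass I γ q * walkClass I γ p := by
  simp only [walkClass]
  rw [Walk.comp_assoc (γ y), FundGroup.mk_comp_mul_mk_comp_inv]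
  simp only [Walk.comp_assoc]

theorem walkClass_inv {x y : V} (p : Walk x y) :
    walkClass I γ p.inv = (walkClass I γ p)⁻¹ := by
  simp only [walkClass, FundGroup.mk_inv, Walk.inv_comp, Walk.inv_inv, Walk.comp_assoc]

theorem walkClass_closed (w : Walk b b) :
    walkClass I γ w = (FundGroup.mk I (γ b))⁻¹ * FundGroup.mk I w * FundGroup.mk I (γ b) := by
  rw [FundGroup.mk_inv, FundGroup.mk_mul_mk, FundGroup.mk_mul_mk, walkClass, Walk.comp_assoc]

variable (I) in
/-- The class of the closed walk `γ'_x⁻¹ γ_x` at the base point, which compares two parade data. -/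
def paradeChange (γ γ' : ParadeData b) (x : V) : FundGroup I b :=
  FundGroup.mk I ((γ x).comp (γ' x).inv)

theorem paradeChange_mul_cl (γ γ' : ParadeData b) {x y : V} (p : Path x y) :
    paradeChange I γ γ' y * cl I γ p = cl I γ' p * paradeChange I γ γ' x := by
  simp only [paradeChange, cl]
  rw [FundGroup.mk_comp_mul_mk_comp_inv, Walk.comp_assoc (γ' x), FundGroup.mk_comp_mul_mk_comp_inv,
    Walk.comp_assoc]

variable {γ} {f : DualGroup k (FundGroup I b)}

theorem dual_walkClass_closed (w : Walk b b) :
    f (Additive.ofMul (walkClass I γ w)) = f (Additive.ofMul (FundGroup.mk I w)) := by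
  rw [walkClass_closed, ofMul_mul, ofMul_mul, ofMul_inv, map_add, map_add, map_neg]
  ring

variable (γ f) in
/-- On the arrows of the subquiver `H`, the homomorphism `f` is the coboundary of the function `c`
on the vertices. -/
def IsCoboundaryOn (H : WideSubquiver V) (c : V → k) : Prop :=
  ∀ ⦃x y : V⦄ (a : x ⟶ y), a ∈ H x y → f (Additive.ofMul (cl I γ a.toPath)) = c y - c x

variable {H : WideSubquiver V} {c : V → k}

theorem IsCoboundaryOn.dual_walkClass_ofSub (hf : IsCoboundaryOn γ f H c) {x y : V}
    (w : SubWalk H x y) : f (Additive.ofMul (walkClass I γ (Walk.ofSub w))) = c y - c x := by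
  refine Walk.ofSub_induction (x := x)
    (P := fun {y} w => f (Additive.ofMul (walkClass I γ w)) = c y - c x) ?_ ?_ ?_ w
  · rw [walkClass_nil, ofMul_one, map_zero, sub_self]
  · intro y z p a ha ih
    rw [walkClass_comp, ofMul_mul, map_add, ih, walkClass_ofPath, hf a ha, sub_add_sub_cancel]
  · intro y z p a ha ih
    rw [walkClass_comp, walkClass_inv, ofMul_mul, ofMul_inv, map_add, map_neg, ih,
      walkClass_ofPath, hf a ha, neg_sub, sub_add_sub_cancel]

theorem IsCoboundaryOn.eq_zero_of_mem_contractSubgroup (hf : IsCoboundaryOn γ f H c)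
    {g : FundGroup I b} (hg : g ∈ contractSubgroup I H b) : f (Additive.ofMul g) = 0 := by
  induction hg using Subgroup.closure_induction with
  | mem g hg =>
    obtain ⟨x, y, u, u', v, rfl⟩ := hg
    rw [← dual_walkClass_closed (γ := γ)]
    simp only [walkClass_comp, walkClass_inv, ofMul_mul, ofMul_inv, map_add, map_neg,
      hf.dual_walkClass_ofSub]
    ring
  | one => exact map_zero f
  | mul g h _ _ hg hh => rw [ofMul_mul, map_add, hg, hh, add_zero]
  | inv g _ hg => rw [ofMul_inv, map_neg, hg, neg_zero]

end WalkClass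

section RelParadeData

variable {V : Type*} [Quiver V] {H : WideSubquiver V} {b : V}

theorem nonempty_relParadeData (H : WideSubquiver V) (hb : ∀ x : V, Nonempty (Walk b x)) :
    Nonempty (RelParadeData H b) := by
  have hroot : ∀ c : WeaklyConnectedComponent H, ∃ x : V, component H x = c := fun c =>
    Quotient.inductionOn c fun x => ⟨x, rfl⟩
  choose root hroot using hroot
  have hsub (y : V) : Nonempty (SubWalk H (root (component H y)) y) :=
    (WeaklyConnectedComponent.eq (V := H) _ y).1 (hroot _)
  exact ⟨⟨root, hroot, fun c => (hb (root c)).some, fun y => (hsub y).some⟩⟩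

theorem walkClass_parade_ofSub_mem {k : Type*} [Field k] [Fintype V] (I : Ideal (PathAlgebra k V))
    (γ : RelParadeData H b) {x y : V} (w : SubWalk H x y) :
    walkClass I γ.parade (Walk.ofSub w) ∈ contractSubgroup I H b := by
  have key : ∀ (c : WeaklyConnectedComponent H) (r : SubWalk H (γ.root c) y),
      c = component H x →
      FundGroup.mk I (((γ.parade x).comp (Walk.ofSub w)).comp
        ((γ.toRoot c).comp (Walk.ofSub r)).inv) ∈ contractSubgroup I H b := by
    rintro c r rfl
    refine Subgroup.subset_closure ⟨_, _, @Walk.comp H _ _ _ _ (γ.fromRoot x) w, r,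
      γ.toRoot _, congrArg (FundGroup.mk I) ?_⟩
    rw [Walk.ofSub_comp]
    simp only [RelParadeData.parade, Walk.inv_comp, Walk.comp_assoc]
  exact key _ (γ.fromRoot y) ((WeaklyConnectedComponent.eq (V := H) x y).2 ⟨w⟩).symm

end RelParadeData

/-! ### Hochschild cohomology and pullback squares -/

section Hochschild

variable {k : Type*} [Field k] {A : Type*} [Ring A] [Algebra k A] {B : Subalgebra k A}

theorem mem_Inn {D : A →ₗ[k] A} : D ∈ Inn k A ↔ ∃ a : A, ∀ x, D x = a * x - x * a := by
  constructor
  · rintro ⟨a, rfl⟩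
    exact ⟨a, fun x => rfl⟩
  · rintro ⟨a, h⟩
    exact ⟨a, LinearMap.ext fun x => (h x).symm⟩

theorem mem_DerRel_iff {D : A →ₗ[k] A} : D ∈ DerRel B ↔ D ∈ Der k A ∧ ∀ c ∈ B, D c = 0 := by
  refine ⟨fun h => ⟨h.1, fun c hc => ?_⟩, fun h => ⟨h.1, fun c hc x => ⟨?_, ?_⟩⟩⟩
  · have h1 : D 1 = 0 := by simpa using h.1 1 1
    have h2 := (h.2 c hc 1).1
    rwa [mul_one, h1, mul_zero] at h2
  · rw [h.1 c x, h.2 c hc, zero_mul, add_zero]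
  · rw [h.1 x c, h.2 c hc, mul_zero, zero_add]

theorem HH1_mk_eq_mk_iff {D E : Der k A} :
    (Submodule.Quotient.mk D : HH1 k A) = Submodule.Quotient.mk E ↔
      ∃ s : A, ∀ x, D.1 x - E.1 x = s * x - x * s :=
  (Submodule.Quotient.eq _).trans mem_Inn

theorem hhInclusion_injective (B : Subalgebra k A) : Function.Injective (hhInclusion B) := by
  rw [← LinearMap.ker_eq_bot, LinearMap.ker_eq_bot']
  intro D hD
  induction D using Submodule.Quotient.induction_on with
  | H D =>
  have hInn : (D : A →ₗ[k] A) ∈ Inn k A :=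
    (Submodule.Quotient.mk_eq_zero ((Inn k A).submoduleOf (Der k A))).1 hD
  exact (Submodule.Quotient.mk_eq_zero _).2 ⟨hInn, D.2.2⟩

variable {G : Type*} [Group G] {N : Subgroup G} [N.Normal]

variable (k N) in
theorem dualInclusion_injective : Function.Injective (dualInclusion k N) := by
  intro f g h
  refine AddMonoidHom.ext fun x => ?_
  induction x using QuotientGroup.induction_on with
  | H x => exact DFunLike.congr_fun h (Additive.ofMul x)

theorem mem_range_dualInclusion_iff {f : DualGroup k G} :
    f ∈ LinearMap.range (dualInclusion k N) ↔ ∀ g ∈ N, f (Additive.ofMul g) = 0 := by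
  constructor
  · rintro ⟨f, rfl⟩ g hg
    exact (congrArg f ((QuotientGroup.eq_one_iff g).2 hg)).trans (map_zero f)
  · intro h
    exact ⟨MonoidHom.toAdditiveLeft (QuotientGroup.lift N (AddMonoidHom.toMultiplicativeRight f)
      fun g hg => congrArg Multiplicative.ofAdd (h g hg)), AddMonoidHom.ext fun _ => rfl⟩

theorem isPullbackSquare_of_injective {W X Y Z : Type*} [AddCommGroup W] [Module k W]
    [AddCommGroup X] [Module k X] [AddCommGroup Y] [Module k Y] [AddCommGroup Z] [Module k Z]
    {i : W →ₗ[k] Y} {h : W →ₗ[k] X} {g : Y →ₗ[k] Z} {j : X →ₗ[k] Z}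
    (hi : Function.Injective i) (hj : Function.Injective j) (hcomm : g ∘ₗ i = j ∘ₗ h)
    (hlift : ∀ y x, g y = j x → y ∈ LinearMap.range i) : IsPullbackSquare i h g j := by
  refine ⟨hcomm, fun U _ _ α β hαβ => ?_⟩
  obtain ⟨l, hl⟩ := i.exists_leftInverse_of_injective (LinearMap.ker_eq_bot.2 hi)
  have hα : i ∘ₗ l ∘ₗ α = α := LinearMap.ext fun u => by
    obtain ⟨w, hw⟩ := hlift (α u) (β u) (LinearMap.congr_fun hαβ u)
    simp only [LinearMap.comp_apply, ← hw]
    exact congrArg i (LinearMap.congr_fun hl w)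
  have hβ : h ∘ₗ l ∘ₗ α = β := LinearMap.ext fun u => hj <|
    calc j (h (l (α u))) = g (i (l (α u))) := (LinearMap.congr_fun hcomm _).symm
      _ = g (α u) := congrArg g (LinearMap.congr_fun hα u)
      _ = j (β u) := LinearMap.congr_fun hαβ u
  refine ⟨l ∘ₗ α, ⟨hα, hβ⟩, fun ψ hψ => ?_⟩
  rw [← hψ.1, ← LinearMap.comp_assoc, hl, LinearMap.id_comp]

end Hochschild

/-! ### Diagonal derivations -/

section DiagonalDerivations

variable {k : Type*} [Field k] {A : Type*} [Ring A] [Algebra k A]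
  {V : Type*} [Quiver V] [Fintype V] {b : V}

namespace Presentation

variable (ν : Presentation k A V)

theorem hom_ext {M : Type*} [AddCommGroup M] [Module k M] {D E : A →ₗ[k] M}
    (h : ∀ {x y : V} (p : Path x y),
      D (ν.map (PathAlgebra.ofPath k p)) = E (ν.map (PathAlgebra.ofPath k p))) : D = E := by
  have hpath : D ∘ₗ ν.map.toLinearMap = E ∘ₗ ν.map.toLinearMap := PathAlgebra.hom_ext h
  refine LinearMap.ext fun x => ?_
  obtain ⟨r, rfl⟩ := ν.surjective x
  exact LinearMap.congr_fun hpath r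

theorem thetaEnd_sub_thetaEnd (γ γ' : ParadeData b) (f : DualGroup k (FundGroup ν.ideal b))
    (a : A) :
    thetaEnd ν γ f a - thetaEnd ν γ' f a =
      ν.map (PathAlgebra.vertexSum fun x => -f (Additive.ofMul (paradeChange ν.ideal γ γ' x))) * a -
      a * ν.map (PathAlgebra.vertexSum
        fun x => -f (Additive.ofMul (paradeChange ν.ideal γ γ' x))) := by
  set s := PathAlgebra.vertexSum fun x => -f (Additive.ofMul (paradeChange ν.ideal γ γ' x))
  suffices h : thetaEnd ν γ f - thetaEnd ν γ' f =
      LinearMap.mulLeft k (ν.map s) - LinearMap.mulRight k (ν.map s) from LinearMap.congr_fun h a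
  refine ν.hom_ext fun {x y} p => ?_
  have hcl := congrArg (fun g => f (Additive.ofMul g)) (paradeChange_mul_cl (I := ν.ideal) γ γ' p)
  simp only [ofMul_mul, map_add] at hcl
  simp only [LinearMap.sub_apply, LinearMap.mulLeft_apply, LinearMap.mulRight_apply,
    thetaEnd_ofPath, ← map_mul, ← map_sub]
  rw [PathAlgebra.vertexSum_commutator_ofPath, map_smul, ← sub_smul]
  congr 1
  linear_combination hcl

theorem theta_eq_theta (γ γ' : ParadeData b) : theta ν γ = theta ν γ' :=
  LinearMap.ext fun f => HH1_mk_eq_mk_iff.2 ⟨_, ν.thetaEnd_sub_thetaEnd γ γ' f⟩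

variable {ν} {γ : ParadeData b} {f : DualGroup k (FundGroup ν.ideal b)}

theorem exists_isCoboundaryOn (hcorner : ∀ x : V, HasSplitCorner k (ν.map (PathAlgebra.vertex k x)))
    (harrow : ∀ (x y : V) (a : x ⟶ y), ν.map (PathAlgebra.arrow k a) ≠ 0) {H : WideSubquiver V}
    {s : A} (hs : ∀ ⦃x y : V⦄ (a : x ⟶ y), a ∈ H x y →
      thetaEnd ν γ f (ν.map (PathAlgebra.arrow k a)) =
        s * ν.map (PathAlgebra.arrow k a) - ν.map (PathAlgebra.arrow k a) * s) :
    ∃ c : V → k, IsCoboundaryOn γ f H c := by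
  choose c hc using fun x => hcorner x s
  refine ⟨c, fun x y a ha => eq_sub_of_smul_eq_commutator (hc x) (hc y) (harrow x y a) ?_ ?_ ?_⟩
  · rw [← map_mul, PathAlgebra.arrow, PathAlgebra.ofPath_mul_vertex]
  · rw [← map_mul, PathAlgebra.arrow, PathAlgebra.vertex_mul_ofPath]
  · exact (thetaEnd_ofPath ν γ f a.toPath).symm.trans (hs a ha)

theorem theta_injective (hcorner : ∀ x : V, HasSplitCorner k (ν.map (PathAlgebra.vertex k x)))
    (harrow : ∀ (x y : V) (a : x ⟶ y), ν.map (PathAlgebra.arrow k a) ≠ 0) (γ : ParadeData b) :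
    Function.Injective (theta ν γ) := by
  rw [← LinearMap.ker_eq_bot, LinearMap.ker_eq_bot']
  intro f hf
  obtain ⟨s, hs⟩ := HH1_mk_eq_mk_iff.1 (hf.trans (Submodule.Quotient.mk_zero _).symm)
  obtain ⟨c, hc⟩ := exists_isCoboundaryOn (H := ⊤) (s := s) (γ := γ) (f := f) hcorner harrow
    fun x y a _ => (sub_zero _).symm.trans (hs _)
  refine AddMonoidHom.ext fun g => hc.eq_zero_of_mem_contractSubgroup (g := g.toMul) ?_
  rw [contractSubgroup_top]
  exact Subgroup.mem_top _

end Presentation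

namespace RelPresentation

variable {B : Subalgebra k A} {QB : WideSubquiver V} (ν : RelPresentation B QB)

theorem map_ofPath {x y : QB} (p : Path x y) :
    ν.presA.map (PathAlgebra.ofPath k ((subInclusion QB).mapPath p)) =
      ν.presB.map (PathAlgebra.ofPath k p) := by
  rw [← ν.comm, PathAlgebra.pathInclusion_ofPath]

theorem map_arrow_mem {x y : V} {a : x ⟶ y} (ha : a ∈ QB x y) :
    ν.presA.map (PathAlgebra.arrow k a) ∈ B := by
  have h : ν.presA.map (PathAlgebra.arrow k a) = _ :=
    ν.map_ofPath (Quiver.Hom.toPath (V := QB) (a := x) (b := y) ⟨a, ha⟩)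
  exact h ▸ Subtype.prop _

theorem thetaEnd_eq_zero_of_mem (γ : RelParadeData QB b)
    {f : DualGroup k (FundGroup ν.presA.ideal b)}
    (hf : ∀ g ∈ contractSubgroup ν.presA.ideal QB b, f (Additive.ofMul g) = 0) {c : A}
    (hc : c ∈ B) : thetaEnd ν.presA γ.parade f c = 0 := by
  suffices h : thetaEnd ν.presA γ.parade f ∘ₗ B.val.toLinearMap = 0 from
    LinearMap.congr_fun h ⟨c, hc⟩
  refine ν.presB.hom_ext fun {x y} p => ?_
  have hp : cl ν.presA.ideal γ.parade ((subInclusion QB).mapPath p) ∈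
      contractSubgroup ν.presA.ideal QB b := by
    rw [← walkClass_ofPath, ← Walk.ofSub_ofPath]
    exact walkClass_parade_ofSub_mem ν.presA.ideal γ _
  change thetaEnd ν.presA γ.parade f (ν.presB.map (PathAlgebra.ofPath k p)) = 0
  rw [← ν.map_ofPath, thetaEnd_ofPath, hf _ hp, zero_smul]

theorem thetaDer_dualInclusion_mem_DerRel (γ : RelParadeData QB b)
    (f : DualGroup k (FundGroup ν.presA.ideal b ⧸ contractSubgroup ν.presA.ideal QB b)) :
    (thetaDer ν.presA γ.parade (dualInclusion k _ f) : A →ₗ[k] A) ∈ DerRel B :=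
  mem_DerRel_iff.2 ⟨Subtype.prop _, fun _ hc =>
    ν.thetaEnd_eq_zero_of_mem γ (mem_range_dualInclusion_iff.1 ⟨f, rfl⟩) hc⟩

/-- The map `θ_ν^{(A|B)} : Hom(π₁(Q_A, I_A)/N_B, k) → HH¹(A|B)`, computed with the relative parade
data `γ`. -/
noncomputable def thetaRel (γ : RelParadeData QB b) :
    DualGroup k (FundGroup ν.presA.ideal b ⧸ contractSubgroup ν.presA.ideal QB b) →ₗ[k]
      HH1Rel B :=
  ((InnRel B).submoduleOf (DerRel B)).mkQ ∘ₗ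
    LinearMap.codRestrict (DerRel B)
      ((Der k A).subtype ∘ₗ thetaDer ν.presA γ.parade ∘ₗ dualInclusion k _)
      (ν.thetaDer_dualInclusion_mem_DerRel γ)

theorem theta_comp_dualInclusion (γ : RelParadeData QB b) (γ' : ParadeData b) :
    theta ν.presA γ' ∘ₗ dualInclusion k (contractSubgroup ν.presA.ideal QB b) =
      hhInclusion B ∘ₗ ν.thetaRel γ := by
  rw [ν.presA.theta_eq_theta γ' γ.parade]
  rfl

theorem thetaRel_eq_thetaRel (γ γ' : RelParadeData QB b) : ν.thetaRel γ = ν.thetaRel γ' := by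
  have h : hhInclusion B ∘ₗ ν.thetaRel γ = hhInclusion B ∘ₗ ν.thetaRel γ' := by
    rw [← ν.theta_comp_dualInclusion γ γ.parade, ν.theta_comp_dualInclusion γ']
  exact LinearMap.ext fun f => hhInclusion_injective B (LinearMap.congr_fun h f)

section SplitCorners

variable (hcorner : ∀ x : V, HasSplitCorner k (ν.presA.map (PathAlgebra.vertex k x)))
  (harrow : ∀ (x y : V) (a : x ⟶ y), ν.presA.map (PathAlgebra.arrow k a) ≠ 0)

include hcorner harrow

theorem thetaRel_injective (γ : RelParadeData QB b) : Function.Injective (ν.thetaRel γ) := by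
  have h : Function.Injective (hhInclusion B ∘ₗ ν.thetaRel γ) := by
    rw [← ν.theta_comp_dualInclusion γ γ.parade]
    exact (Presentation.theta_injective hcorner harrow γ.parade).comp (dualInclusion_injective k _)
  exact Function.Injective.of_comp (f := hhInclusion B) h

theorem mem_range_dualInclusion_of_theta_eq_hhInclusion {γ : ParadeData b}
    {f : DualGroup k (FundGroup ν.presA.ideal b)} {D : HH1Rel B}
    (h : theta ν.presA γ f = hhInclusion B D) :
    f ∈ LinearMap.range (dualInclusion k (contractSubgroup ν.presA.ideal QB b)) := by
  induction D using Submodule.Quotient.induction_on with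
  | H D =>
  obtain ⟨s, hs⟩ := HH1_mk_eq_mk_iff.1 h
  have hsB : ∀ c ∈ B, thetaEnd ν.presA γ f c = s * c - c * s := fun c hc => by
    have hD : (D : A →ₗ[k] A) c = 0 := (mem_DerRel_iff.1 D.2).2 c hc
    rw [← hs c, ← sub_zero (thetaEnd ν.presA γ f c), ← hD]
    rfl
  obtain ⟨c, hc⟩ := Presentation.exists_isCoboundaryOn hcorner harrow
    fun x y a ha => hsB _ (ν.map_arrow_mem ha)
  exact mem_range_dualInclusion_iff.2 fun g hg => hc.eq_zero_of_mem_contractSubgroup hg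

theorem isPullbackSquare_theta (γ : RelParadeData QB b) (γ' : ParadeData b) :
    IsPullbackSquare (dualInclusion k (contractSubgroup ν.presA.ideal QB b)) (ν.thetaRel γ)
      (theta ν.presA γ') (hhInclusion B) :=
  isPullbackSquare_of_injective (dualInclusion_injective k _) (hhInclusion_injective B)
    (ν.theta_comp_dualInclusion γ γ') fun _ _ =>
      ν.mem_range_dualInclusion_of_theta_eq_hhInclusion hcorner harrow

end SplitCorners

end RelPresentation

end DiagonalDerivations

end RelHH

theorem theoremC_general {k : Type u₀} [Field k] {A : Type u₁} [Ring A] [Algebra k A]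
    {V : Type u₂} [Quiver.{u₃} V] [Fintype V]
    (B : Subalgebra k A) (QB : WideSubquiver V) (ν : RelPresentation B QB)
    (hconn : ∀ x y : V, Nonempty (Walk x y))
    (hcorner : ∀ x : V, HasSplitCorner k (ν.presA.map (PathAlgebra.vertex k x)))
    (harrow : ∀ (x y : V) (a : x ⟶ y), ν.presA.map (PathAlgebra.arrow k a) ≠ 0)
    (b : V) :
    Nonempty (RelParadeData QB b) ∧
    (∀ γ γ' : ParadeData b, theta ν.presA γ = theta ν.presA γ') ∧
    ∃ θAB : DualGroup k (FundGroup ν.presA.ideal b ⧸ contractSubgroup ν.presA.ideal QB b) →ₗ[k]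
        HH1Rel B,
      (∀ (γ : RelParadeData QB b)
        (f : DualGroup k (FundGroup ν.presA.ideal b ⧸ contractSubgroup ν.presA.ideal QB b)),
        ∃ h : (thetaDer ν.presA γ.parade (dualInclusion k _ f) : A →ₗ[k] A) ∈ DerRel B,
          θAB f = Submodule.Quotient.mk ⟨_, h⟩) ∧
      Function.Injective θAB ∧
      ∀ γ : ParadeData b,
        IsPullbackSquare.{t} (dualInclusion k (contractSubgroup ν.presA.ideal QB b)) θAB
          (theta ν.presA γ) (hhInclusion B) := by
  obtain ⟨γ₀⟩ := nonempty_relParadeData QB (hconn b)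
  refine ⟨⟨γ₀⟩, ν.presA.theta_eq_theta, ν.thetaRel γ₀, fun γ f => ?_,
    ν.thetaRel_injective hcorner harrow γ₀, ν.isPullbackSquare_theta hcorner harrow γ₀⟩
  exact ⟨ν.thetaDer_dualInclusion_mem_DerRel γ f,
    LinearMap.congr_fun (ν.thetaRel_eq_thetaRel γ₀ γ) f⟩

theorem theoremC {k : Type u₀} [Field k] [IsAlgClosed k] {A : Type u₁} [Ring A] [Algebra k A]
    [FiniteDimensional k A] {V : Type u₂} [Quiver.{u₃} V] [Fintype V]
    (B : Subalgebra k A) (QB : WideSubquiver V) (ν : RelPresentation B QB)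
    (hconn : ∀ x y : V, Nonempty (Walk x y))
    (hprim : ∀ x : V, IsPrimitiveIdempotent (ν.presA.map (PathAlgebra.vertex k x)))
    (harrow : ∀ (x y : V) (a : x ⟶ y), ν.presA.map (PathAlgebra.arrow k a) ≠ 0)
    (b : V) :
    Nonempty (RelParadeData QB b) ∧
    (∀ γ γ' : ParadeData b, theta ν.presA γ = theta ν.presA γ') ∧
    ∃ θAB : DualGroup k (FundGroup ν.presA.ideal b ⧸ contractSubgroup ν.presA.ideal QB b) →ₗ[k]
        HH1Rel B,
      (∀ (γ : RelParadeData QB b)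
        (f : DualGroup k (FundGroup ν.presA.ideal b ⧸ contractSubgroup ν.presA.ideal QB b)),
        ∃ h : (thetaDer ν.presA γ.parade (dualInclusion k _ f) : A →ₗ[k] A) ∈ DerRel B,
          θAB f = Submodule.Quotient.mk ⟨_, h⟩) ∧
      Function.Injective θAB ∧
      ∀ γ : ParadeData b,
        IsPullbackSquare.{t} (dualInclusion k (contractSubgroup ν.presA.ideal QB b)) θAB
          (theta ν.presA γ) (hhInclusion B) :=
  theoremC_general B QB ν hconn (fun x => (hprim x).hasSplitCorner) harrow b
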